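/- Let $\lambda$ be Lebesgue measure on $\mathbb{R}^d$. Let $(\Omega,\mathcal F)$ be a measurable space, let $(E,\mathcal E)$ be a measurable space with an action $(\theta_t)_{t\in\mathbb{R}^d}$ of the additive group $\mathbb{R}^d$ such that $(t,x)\mapsto\theta_t x$ is measurable, and let $X$ be a random element in $E$. Let $Z=(Z_s)_{s\in\mathbb{R}^d}$ be a shift-measurable random field with values in $[0,\infty)$, i.e. a random element of a shift-invariant set of paths, equipped with the trace of the product $\sigma$-algebra, on which $(t,z)\mapsto\theta_t z:=(z_{t+s})_{s\in\mathbb{R}^d}$ is jointly measurable. Let $\xi$ be a (locally finite) random measure on $\mathbb{R}^d$ with density field $Z$, that is, $\xi(ds)=Z_s\,ds$, and assume that $Z_s>0$ for all $s\in\mathbb{R}^d$, everywhere on $\Omega$. Put $\theta_t\xi(B):=\xi(B+t)$ for Borel $B$, and let shifts act componentwise on tuples. For any measure $\mathbf{Q}$ on $\Omega$ (not necessarily finite), a random element $Y$ is called stationary under $\mathbf{Q}$ if $\theta_tY\overset{D}{=}Y$ under $\mathbf{Q}$ for all $t\in\mathbb{R}^d$. Let $\mathbf{P}^\circ$ be a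 measure on $(\Omega,\mathcal F)$, not necessarily finite, under which $((X,Z),\xi)$ has a $\sigma$-finite distribution, and suppose that $((X,Z),\xi)$ is mass-stationary under $\mathbf{P}^\circ$: $0$ lies in the support of $\xi$ $\mathbf{P}^\circ$-a.e., and, for every bounded Borel set $C\subset\mathbb{R}^d$ with $\lambda(C)>0$ and $\lambda(\partial C)=0$, $$\big(\theta_{V_C}((X,Z),\xi),\,V_C+U_C\big)\overset{D}{=}\big(((X,Z),\xi),\,U_C\big)\quad\text{under }\mathbf{P}^\circ,$$ where the conditional distribution of $U_C$ given $((X,Z),\xi)$ is uniform on $C$ and the conditional distribution of $V_C$ given $(((X,Z),\xi),U_C)$ is $\xi(\,\cdot\mid C-U_C)$. Define a measure $\mathbf{P}$ on $(\Omega,\mathcal F)$ by $d\mathbf{P}=\frac1{Z_0}\,d\mathbf{P}^\circ$. Then the distribution of $((X,Z),\xi)$ under $\mathbf{P}$ is $\sigma$-finite, $(X,Z)$ is stationary under $\mathbf{P}$, and $((X,Z),\xi)$ under $\mathbf{P}^\circ$ is the Palm version of $((X,Z),\xi)$ under $\mathbf{P}$; that is, $((X,Z),\xi)$ is stationary under $\mathbf{P}$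 and, for every nonnegative measurable $f$ and every Borel set $B\subset\mathbb{R}^d$ with $0<\lambda(B)<\infty$, $$\mathbf{E}^\circ\big[f((X,Z),\xi)\big]=\frac{1}{\lambda(B)}\,\mathbf{E}\Big[\int_B f\big(\theta_t((X,Z),\xi)\big)\,\xi(dt)\Big],$$ where $\mathbf{E}^\circ$ and $\mathbf{E}$ denote integration with respect to $\mathbf{P}^\circ$ and $\mathbf{P}$. -/

import Mathlib

open MeasureTheory ProbabilityTheory
open scoped ENNReal NNReal

/-- The Euclidean space `ℝ^d`. -/
abbrev Rd (d : ℕ) : Type := EuclideanSpace ℝ (Fin d)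

/-! ### The space of locally finite measures on `ℝ^d` -/

/-- Locally finite Borel measures on `ℝ^d`; a random measure is a random element of this space. -/
def LocFinMeasure (d : ℕ) : Type := {μ : Measure (Rd d) // IsLocallyFiniteMeasure μ}

namespace LocFinMeasure

variable {d : ℕ}

/-- The underlying measure. -/
def toMeasure (μ : LocFinMeasure d) : Measure (Rd d) := μ.1

/-- The `σ`-algebra generated by the evaluations `μ ↦ μ B`, `B` Borel. -/
instance : MeasurableSpace (LocFinMeasure d) :=
  MeasurableSpace.comap LocFinMeasure.toMeasure inferInstance

@[ext] theorem ext {μ ν : LocFinMeasure d} (h : μ.toMeasure = ν.toMeasure) : μ = ν :=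
  Subtype.ext h

theorem isLocallyFiniteMeasure_shift (t : Rd d) (μ : LocFinMeasure d) :
    IsLocallyFiniteMeasure (μ.toMeasure.map (fun y => y - t)) := by
  have h : IsLocallyFiniteMeasure μ.toMeasure := μ.2
  refine ⟨fun x => ?_⟩
  obtain ⟨s, hs, hfin⟩ := μ.toMeasure.finiteAt_nhds (x + t)
  refine ⟨(fun y => y + t) ⁻¹' s, (continuous_add_const t).continuousAt hs, ?_⟩
  have hm : (fun y : Rd d => y - t) = ⇑(MeasurableEquiv.subRight t) := rfl
  rw [hm, MeasurableEquiv.map_apply]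
  refine lt_of_le_of_lt (measure_mono ?_) hfin
  intro y hy
  have e : MeasurableEquiv.subRight t y = y - t := rfl
  simpa [e] using hy

/-- The shift `θ_t μ`, with `θ_t μ (B) = μ (B + t)`. -/
noncomputable def shift (t : Rd d) (μ : LocFinMeasure d) : LocFinMeasure d :=
  ⟨μ.toMeasure.map (fun y => y - t), isLocallyFiniteMeasure_shift t μ⟩

theorem toMeasure_shift (t : Rd d) (μ : LocFinMeasure d) :
    (shift t μ).toMeasure = μ.toMeasure.map (fun y => y - t) := rfl

/-- The shifts as an action of `ℝ^d`: `t +ᵥ μ = θ_t μ`. -/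
noncomputable instance : AddAction (Rd d) (LocFinMeasure d) where
  vadd := shift
  zero_vadd μ := by
    apply LocFinMeasure.ext
    change μ.toMeasure.map (fun y => y - 0) = _
    simp
  add_vadd s t μ := by
    apply LocFinMeasure.ext
    change μ.toMeasure.map (fun y => y - (s + t)) =
      (μ.toMeasure.map (fun y => y - t)).map (fun y => y - s)
    rw [Measure.map_map (by fun_prop) (by fun_prop)]
    congr 1
    funext y
    simp [sub_sub, add_comm]

end LocFinMeasure

/-! ### Shift-measurable random fields with values in `[0, ∞)` -/

/-- A path space for shift-measurable random fields `(z_s)_{s ∈ ℝ^d}` with values in `[0, ∞)`: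
a shift-invariant set of paths on which `(t, z) ↦ θ_t z = (z_{t+s})_s` is jointly measurable, the
set of paths being equipped with the (trace of the) product `σ`-algebra. -/
structure FieldSpace (d : ℕ) where
  /-- the set of paths -/
  carrier : Set (Rd d → ℝ≥0)
  shift_mem : ∀ (t : Rd d) (z : Rd d → ℝ≥0), z ∈ carrier → (fun s => z (t + s)) ∈ carrier
  measurable_shift : Measurable (fun p : Rd d × carrier =>
    (⟨fun s => p.2.1 (p.1 + s), shift_mem p.1 p.2.1 p.2.2⟩ : carrier))

namespace FieldSpace

variable {d : ℕ}

/-- The elements (paths) of a path space. -/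
def Path (F : FieldSpace d) : Type := F.carrier

instance (F : FieldSpace d) : CoeFun F.Path (fun _ => Rd d → ℝ≥0) := ⟨fun z => z.1⟩

/-- The trace of the product `σ`-algebra, i.e. the one generated by the evaluations. -/
instance (F : FieldSpace d) : MeasurableSpace F.Path :=
  inferInstanceAs (MeasurableSpace F.carrier)

/-- The shifts as an action of `ℝ^d`: `t +ᵥ z = θ_t z = (z_{t+s})_s`. -/
instance (F : FieldSpace d) : AddAction (Rd d) F.Path where
  vadd t z := ⟨fun s => z (t + s), F.shift_mem t z.1 z.2⟩
  zero_vadd z := Subtype.ext (funext fun s => congrArg z.1 (zero_add s))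
  add_vadd t u z := Subtype.ext (funext fun s => congrArg z.1
    (show t + u + s = u + (t + s) by rw [add_comm t u, add_assoc]))

end FieldSpace

/-! ### Stationarity, mass-stationarity, Palm versions -/

/-- The random element `Y` is stationary under `P`: `θ_t Y` and `Y` have the same distribution
under `P`, for every `t ∈ ℝ^d`. (Here `P` need not be a probability measure.) -/
def IsStationaryUnder (d : ℕ) {Ω E : Type*} [MeasurableSpace Ω] [MeasurableSpace E]
    [AddAction (Rd d) E] (P : Measure Ω) (Y : Ω → E) : Prop :=
  ∀ t : Rd d, IdentDistrib (fun ω => t +ᵥ Y ω) Y P P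

section Stationarity

variable {d : ℕ} {Ω Ω' E : Type*} [MeasurableSpace Ω] [MeasurableSpace Ω']
  [MeasurableSpace E] [AddAction (Rd d) E]

/-- The pair `(X, ξ)` is mass-stationary under `P`: the origin lies in the support of `ξ` almost
everywhere and, for every bounded Borel set `C` with `λ(C) > 0` and `λ(∂C) = 0`, the elements
`(θ_V (X, ξ), V + U)` and `((X, ξ), U)` have the same distribution under `P`, where `U` is, given
`(X, ξ)`, uniform on `C` and `V` has, given `((X, ξ), U)`, the conditional distribution
`ξ( · | C - U)`. Both distributions are given by their integrals of nonnegative measurable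
functions; the set `{y | y + u ∈ C}` is `C - u`. -/
def IsMassStationary (P : Measure Ω) (X : Ω → E) (ξ : Ω → LocFinMeasure d) : Prop :=
  (∀ᵐ ω ∂P, (0 : Rd d) ∈ (ξ ω).toMeasure.support) ∧
  ∀ C : Set (Rd d), Bornology.IsBounded C → MeasurableSet C → 0 < volume C →
    volume (frontier C) = 0 →
    ∀ f : (E × LocFinMeasure d) × Rd d → ℝ≥0∞, Measurable f →
      ∫⁻ ω, ∫⁻ u, ∫⁻ v, f (v +ᵥ (X ω, ξ ω), v + u)
          ∂((ξ ω).toMeasure[|{y | y + u ∈ C}]) ∂((volume : Measure (Rd d))[|C]) ∂P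
        = ∫⁻ ω, ∫⁻ u, f ((X ω, ξ ω), u) ∂((volume : Measure (Rd d))[|C]) ∂P

/-- `(Y, η)` under `Q` is the Palm version of the stationary pair `(X, ξ)` under `P`. -/
def IsPalmVersion (Q : Measure Ω') (Y : Ω' → E) (η : Ω' → LocFinMeasure d)
    (P : Measure Ω) (X : Ω → E) (ξ : Ω → LocFinMeasure d) : Prop :=
  IsStationaryUnder d P (fun ω => (X ω, ξ ω)) ∧
  ∀ f : E × LocFinMeasure d → ℝ≥0∞, Measurable f →
    ∀ B : Set (Rd d), MeasurableSet B → 0 < volume B → volume B < ∞ →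
      ∫⁻ ω, f (Y ω, η ω) ∂Q
        = (∫⁻ ω, ∫⁻ t in B, f (t +ᵥ (X ω, ξ ω)) ∂((ξ ω).toMeasure) ∂P) / volume B

end Stationarity

/-! Write $W=(X,Z)$. Testing mass-stationarity with $D\cdot 1_R$, where $D=\xi(C-U_C)$ is the
normalising constant of the law of $V_C$, removes the normalisation: $D$ does not change when
$(W,U_C)$ is replaced by $(\theta_{V_C}W,V_C+U_C)$. What remains
(`IsMassStationary.lintegral_balance`) is a symmetry of the measure $Z_v\,\mathbf
P^\circ(d\omega)\,du\,dv$ on pairs of sites $u$, $v+u$ in $C$: seeing the field from the second site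
and exchanging the two sites changes nothing.

The restriction to $C$ is then lifted. Letting $C$ vary, the symmetry is known on boxes with both
sites in the same $C$, and differences of such boxes yield all boxes
(`measure_eq_of_diagonal_boxes`, `map_shiftedPairMeasure_eq`).

A test function that cancels the density turns the full symmetry into $\mathbf E\int_A
h(\theta_vW)\,dv=\lambda(A)\,\mathbf E\,h(W)$ (`lintegral_average_shift_eq`). This one identity
gives both conclusions: stationarity by translating $A$, and Palm's formula by taking $h=Z_0f$.
Since $\xi$ is a measurable function of $Z$, it suffices to work with $W$. -/

/-! ### Jordan sets and measures determined by diagonal boxes -/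

/-- Bounded Borel sets whose boundary is Lebesgue null. -/
def IsJordanSet {d : ℕ} (C : Set (Rd d)) : Prop :=
  Bornology.IsBounded C ∧ MeasurableSet C ∧ volume (frontier C) = 0

namespace IsJordanSet

variable {d : ℕ} {C D : Set (Rd d)}

theorem inter (hC : IsJordanSet C) (hD : IsJordanSet D) : IsJordanSet (C ∩ D) := by
  refine ⟨hC.1.subset Set.inter_subset_left, hC.2.1.inter hD.2.1, ?_⟩
  refine measure_mono_null (frontier_inter_subset C D) (measure_union_null ?_ ?_)
  · exact measure_mono_null Set.inter_subset_left hC.2.2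
  · exact measure_mono_null Set.inter_subset_right hD.2.2

theorem diff (hC : IsJordanSet C) (hD : IsJordanSet D) : IsJordanSet (C \ D) := by
  refine ⟨hC.1.subset Set.sdiff_subset, hC.2.1.diff hD.2.1, ?_⟩
  rw [Set.sdiff_eq]
  refine measure_mono_null (frontier_inter_subset C Dᶜ) (measure_union_null ?_ ?_)
  · exact measure_mono_null Set.inter_subset_left hC.2.2
  · rw [frontier_compl]
    exact measure_mono_null Set.inter_subset_right hD.2.2

theorem ball (x : Rd d) {r : ℝ} (hr : 0 < r) : IsJordanSet (Metric.ball x r) := by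
  refine ⟨Metric.isBounded_ball, measurableSet_ball, ?_⟩
  rw [frontier_ball x hr.ne']
  exact Measure.addHaar_sphere_of_ne_zero volume x hr.ne'

theorem isPiSystem : IsPiSystem {C : Set (Rd d) | IsJordanSet C} :=
  fun _ hC _ hD _ => hC.inter hD

theorem generateFrom :
    MeasurableSpace.generateFrom {C : Set (Rd d) | IsJordanSet C} =
      (inferInstance : MeasurableSpace (Rd d)) := by
  refine le_antisymm (MeasurableSpace.generateFrom_le fun C hC => hC.2.1) ?_
  have hbasis : TopologicalSpace.IsTopologicalBasis
      {U : Set (Rd d) | ∃ x r, 0 < r ∧ U = Metric.ball x r} := by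
    refine TopologicalSpace.isTopologicalBasis_of_isOpen_of_nhds ?_ ?_
    · rintro _ ⟨x, r, -, rfl⟩
      exact Metric.isOpen_ball
    · intro x U hx hU
      obtain ⟨r, hr, hrU⟩ := Metric.isOpen_iff.1 hU x hx
      exact ⟨_, ⟨x, r, hr, rfl⟩, Metric.mem_ball_self hr, hrU⟩
  change (inferInstance : MeasurableSpace (Rd d)) ≤ _
  rw [BorelSpace.measurable_eq (α := Rd d), hbasis.borel_eq_generateFrom]
  refine MeasurableSpace.generateFrom_mono ?_
  rintro _ ⟨x, r, hr, rfl⟩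
  exact ball x hr

theorem isCountablySpanning : IsCountablySpanning {C : Set (Rd d) | IsJordanSet C} :=
  ⟨fun n : ℕ => Metric.ball 0 (n + 1 : ℝ), fun n => ball 0 (by positivity), by
    refine Set.eq_univ_of_forall fun x => ?_
    obtain ⟨n, hn⟩ := exists_nat_gt ‖x‖
    exact Set.mem_iUnion.2 ⟨n, by simpa using hn.trans (lt_add_one _)⟩⟩

end IsJordanSet

/-- Two measures on `(α × ℝ^d) × ℝ^d` which agree on the diagonal boxes `(R ∩ (α × C)) × C` with `C`
a Jordan set are equal, provided one of them is finite on suitable bounded sets. -/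
theorem measure_eq_of_diagonal_boxes {d : ℕ} {α ι : Type*} [MeasurableSpace α] [Countable ι]
    {M N : Measure ((α × Rd d) × Rd d)} (T : ι → Set α) (hT : ∀ i, MeasurableSet (T i))
    (r : ι → ℝ) (hr : ∀ i, 0 < r i) (hcover : ∀ a (ρ : ℝ), ∃ i, a ∈ T i ∧ ρ < r i)
    (hfin : ∀ i, M ((T i ×ˢ Metric.ball 0 (r i)) ×ˢ Metric.ball 0 (r i)) ≠ ∞)
    (h : ∀ C : Set (Rd d), IsJordanSet C → ∀ R : Set (α × Rd d), MeasurableSet R →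
      M ((R ∩ Prod.snd ⁻¹' C) ×ˢ C) = N ((R ∩ Prod.snd ⁻¹' C) ×ˢ C)) : M = N := by
  have hcov : ⋃ i, (T i ×ˢ Metric.ball (0 : Rd d) (r i)) ×ˢ Metric.ball (0 : Rd d) (r i)
      = Set.univ := by
    refine Set.eq_univ_of_forall fun p => ?_
    obtain ⟨i, hi, hρ⟩ := hcover p.1.1 (max ‖p.1.2‖ ‖p.2‖)
    refine Set.mem_iUnion.2 ⟨i, ?_⟩
    simp only [Set.mem_prod, Metric.mem_ball, dist_zero_right]
    exact ⟨⟨hi, (le_max_left _ _).trans_lt hρ⟩, (le_max_right _ _).trans_lt hρ⟩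
  rw [Measure.ext_iff_of_iUnion_eq_univ hcov]
  intro i
  set B : Set (Rd d) := Metric.ball 0 (r i) with hB
  have hBJ : IsJordanSet B := IsJordanSet.ball 0 (hr i)
  have hKm : MeasurableSet ((T i ×ˢ B) ×ˢ B) := ((hT i).prod hBJ.2.1).prod hBJ.2.1
  have key : ∀ R : Set (α × Rd d), MeasurableSet R → R ⊆ T i ×ˢ B →
      ∀ C : Set (Rd d), IsJordanSet C → C ⊆ B → M (R ×ˢ C) = N (R ×ˢ C) := by
    intro R hR hRB C hC hCB
    have hCp : MeasurableSet (Prod.snd ⁻¹' C : Set (α × Rd d)) := measurable_snd hC.2.1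
    -- `R₂` lies over `B \ C`. Hence `R₂ ×ˢ C` is the difference of `R₂ ×ˢ B` and `R₂ ×ˢ (B \ C)`,
    -- and both of these are diagonal boxes, for the Jordan sets `B` and `B \ C`.
    set R₂ := R \ Prod.snd ⁻¹' C with hR₂
    have hR₂m : MeasurableSet R₂ := hR.diff hCp
    have e₁ := h C hC R hR
    have hD := hBJ.diff hC
    have e₂ := h B hBJ R₂ hR₂m
    have e₃ := h (B \ C) hD R₂ hR₂m
    have s₂ : R₂ ∩ Prod.snd ⁻¹' B = R₂ := Set.inter_eq_left.2 fun p hp => (hRB hp.1).2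
    have s₃ : R₂ ∩ Prod.snd ⁻¹' (B \ C) = R₂ :=
      Set.inter_eq_left.2 fun p hp => ⟨(hRB hp.1).2, hp.2⟩
    rw [s₂] at e₂
    rw [s₃] at e₃
    have hsplit : ∀ L : Measure ((α × Rd d) × Rd d),
        L (R₂ ×ˢ B) = L (R₂ ×ˢ C) + L (R₂ ×ˢ (B \ C)) := by
      intro L
      rw [← measure_union ?_ (hR₂m.prod hD.2.1), ← Set.prod_union, Set.union_sdiff_cancel hCB]
      exact Set.disjoint_left.2 fun p hp hp' => hp'.2.2 hp.2
    have hsplit' : ∀ L : Measure ((α × Rd d) × Rd d),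
        L (R ×ˢ C) = L ((R ∩ Prod.snd ⁻¹' C) ×ˢ C) + L (R₂ ×ˢ C) := by
      intro L
      rw [← measure_union ?_ (hR₂m.prod hC.2.1), ← Set.union_prod, Set.inter_union_sdiff]
      exact Set.disjoint_left.2 fun p hp hp' => hp'.1.2 hp.1.2
    have hfin₃ : N (R₂ ×ˢ (B \ C)) ≠ ∞ := by
      rw [← e₃]
      exact ne_top_of_le_ne_top (hfin i) (measure_mono
        (Set.prod_mono (Set.sdiff_subset.trans hRB) Set.sdiff_subset))
    rw [hsplit M, hsplit N, e₃, ENNReal.add_left_inj hfin₃] at e₂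
    rw [hsplit' M, hsplit' N, e₁, e₂]
  have : IsFiniteMeasure (M.restrict ((T i ×ˢ B) ×ˢ B)) :=
    ⟨by rw [Measure.restrict_apply_univ]; exact (hfin i).lt_top⟩
  refine ext_of_generate_finite
    (Set.image2 (· ×ˢ ·) {R : Set (α × Rd d) | MeasurableSet R} {C : Set (Rd d) | IsJordanSet C})
    (generateFrom_eq_prod MeasurableSpace.generateFrom_measurableSet IsJordanSet.generateFrom
      isCountablySpanning_measurableSet IsJordanSet.isCountablySpanning).symm
    (MeasurableSpace.isPiSystem_measurableSet.prod IsJordanSet.isPiSystem) ?_ ?_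
  · rintro _ ⟨R, hR, C, hC, rfl⟩
    simp only [Measure.restrict_apply' hKm]
    rw [Set.prod_inter_prod]
    exact key _ (MeasurableSet.inter hR ((hT i).prod hBJ.2.1)) Set.inter_subset_right _
      (IsJordanSet.inter hC hBJ) Set.inter_subset_right
  · simp only [Measure.restrict_apply_univ]
    exact key _ ((hT i).prod hBJ.2.1) subset_rfl _ hBJ subset_rfl

/-! ### From the two-site symmetry to invariance under shifts -/

section ShiftInvariance

variable {d : ℕ} {Ω G : Type*} [MeasurableSpace Ω] [MeasurableSpace G] [AddAction (Rd d) G]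
  [MeasurableVAdd₂ (Rd d) G]

theorem measurable_vadd_comp {α : Type*} [MeasurableSpace α] {s : α → Rd d} {w : α → G}
    (hs : Measurable s) (hw : Measurable w) : Measurable (fun a => s a +ᵥ w a) :=
  measurable_vadd.comp (hs.prodMk hw)

/-- The measure `g(v + W(ω)) Q(dω) du dv`. -/
noncomputable def shiftedPairMeasure (Q : Measure Ω) (W : Ω → G) (g : G → ℝ≥0) :
    Measure (Ω × Rd d × Rd d) :=
  (Q.prod (volume.prod volume)).withDensity fun p => (g (p.2.2 +ᵥ W p.1) : ℝ≥0∞)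

theorem lintegral_map_shiftedPairMeasure {α : Type*} [MeasurableSpace α] {Q : Measure Ω}
    [SFinite Q] {W : Ω → G} (hW : Measurable W) {g : G → ℝ≥0} (hg : Measurable g)
    {e : Ω × Rd d × Rd d → α} (he : Measurable e) {F : α → ℝ≥0∞} (hF : Measurable F) :
    ∫⁻ p, F p ∂((shiftedPairMeasure Q W g).map e) =
      ∫⁻ ω, ∫⁻ u, ∫⁻ v, g (v +ᵥ W ω) * F (e (ω, u, v)) ∂volume ∂volume ∂Q := by
  have hm : Measurable fun p : Ω × Rd d × Rd d => (g (p.2.2 +ᵥ W p.1) : ℝ≥0∞) :=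
    (hg.comp (measurable_vadd_comp (by fun_prop) (by fun_prop))).coe_nnreal_ennreal
  have hm' : Measurable fun p : Ω × Rd d × Rd d => (g (p.2.2 +ᵥ W p.1) : ℝ≥0∞) * F (e p) :=
    hm.mul (hF.comp he)
  rw [lintegral_map hF he, shiftedPairMeasure]
  refine (lintegral_withDensity_eq_lintegral_mul _ hm (hF.comp he)).trans ?_
  refine (lintegral_prod _ hm'.aemeasurable).trans (lintegral_congr fun ω => ?_)
  exact lintegral_prod _ (hm'.comp measurable_prodMk_left).aemeasurable

/-- `hbal` is exactly the equality of the two images on diagonal boxes. Local integrability of the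
density along orbits and σ-finiteness of the law of `W` supply the finiteness needed to extend it to
all sets. -/
theorem map_shiftedPairMeasure_eq {Q : Measure Ω} {W : Ω → G}
    (hW : Measurable W) [SigmaFinite (Q.map W)] {g : G → ℝ≥0} (hg : Measurable g)
    (hfin : ∀ ω (r : ℝ), ∫⁻ v in Metric.ball (0 : Rd d) r, g (v +ᵥ W ω) ≠ ∞)
    (hbal : ∀ C : Set (Rd d), IsJordanSet C → ∀ R : Set (G × Rd d), MeasurableSet R →
      ∫⁻ ω, ∫⁻ u in C, ∫⁻ v in {v | v + u ∈ C},
          g (v +ᵥ W ω) * R.indicator 1 (v +ᵥ W ω, v + u) ∂volume ∂volume ∂Q =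
        ∫⁻ ω, ∫⁻ u in C, ∫⁻ v in {v | v + u ∈ C},
          g (v +ᵥ W ω) * R.indicator 1 (W ω, u) ∂volume ∂volume ∂Q) :
    (shiftedPairMeasure Q W g).map
        (fun p : Ω × Rd d × Rd d => ((p.2.2 +ᵥ W p.1, p.2.2 + p.2.1), p.2.1)) =
      (shiftedPairMeasure Q W g).map (fun p : Ω × Rd d × Rd d => ((W p.1, p.2.1), p.2.2 + p.2.1)) := by
  have hm₁ : Measurable fun p : Ω × Rd d × Rd d =>
      ((p.2.2 +ᵥ W p.1, p.2.2 + p.2.1), p.2.1) :=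
    ((measurable_vadd_comp (by fun_prop) (by fun_prop)).prodMk (by fun_prop)).prodMk
      (by fun_prop)
  have hm₂ : Measurable fun p : Ω × Rd d × Rd d => ((W p.1, p.2.1), p.2.2 + p.2.1) := by
    fun_prop
  have hvu : ∀ {C : Set (Rd d)}, MeasurableSet C → ∀ u, MeasurableSet {v : Rd d | v + u ∈ C} :=
    fun hC u => (measurable_add_const u) hC
  have : SigmaFinite Q := SigmaFinite.of_map Q hW.aemeasurable inferInstance
  let I : ℝ → G → ℝ≥0∞ := fun r w => ∫⁻ v in Metric.ball (0 : Rd d) r, g (v +ᵥ w)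
  have hI : ∀ r, Measurable (I r) := fun r =>
    Measurable.lintegral_prod_right'
      (f := fun p : G × Rd d => (g (p.2 +ᵥ p.1) : ℝ≥0∞))
      (hg.comp (measurable_vadd_comp measurable_snd measurable_fst)).coe_nnreal_ennreal
  let ρ : ℕ × ℕ × ℕ → ℝ := fun i => i.1 + 1
  -- The sets must cover all of `G`, so points with infinite integral are admitted; by `hfin` no
  -- value of `W` is such a point.
  let T : ℕ × ℕ × ℕ → Set G := fun i =>
    {w | I (2 * ρ i) w ≤ i.2.1 ∨ I (2 * ρ i) w = ∞} ∩ spanningSets (Q.map W) i.2.2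
  have hTm : ∀ i, MeasurableSet (T i) := fun i =>
    ((measurableSet_le (hI _) measurable_const).union
      (measurableSet_eq_fun (hI _) measurable_const)).inter (measurableSet_spanningSets _ _)
  -- Finiteness is checked on the image in which `W` is not shifted, where the spanning sets of its
  -- law apply directly.
  symm
  refine measure_eq_of_diagonal_boxes T hTm ρ (fun i => by positivity) ?_ ?_ ?_
  · intro w r
    obtain ⟨n, hn⟩ := exists_nat_gt r
    obtain ⟨k, hk⟩ := Set.mem_iUnion.1
      ((iUnion_spanningSets (Q.map W)).symm ▸ Set.mem_univ w)
    obtain ⟨m, hm⟩ : ∃ m : ℕ, I (2 * (n + 1 : ℝ)) w ≤ m ∨ I (2 * (n + 1 : ℝ)) w = ∞ := by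
      by_cases h : I (2 * (n + 1 : ℝ)) w = ∞
      · exact ⟨0, Or.inr h⟩
      · obtain ⟨m, hm⟩ := ENNReal.exists_nat_gt h
        exact ⟨m, Or.inl hm.le⟩
    exact ⟨(n, m, k), ⟨hm, hk⟩, hn.trans (lt_add_one _)⟩
  · intro i
    set B : Set (Rd d) := Metric.ball 0 (ρ i)
    have hB : MeasurableSet B := measurableSet_ball
    have hset : MeasurableSet ((T i ×ˢ B) ×ˢ B) := ((hTm i).prod hB).prod hB
    rw [← lintegral_indicator_one hset,
      lintegral_map_shiftedPairMeasure hW hg hm₂ (measurable_one.indicator hset)]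
    have hle : ∀ ω, ∫⁻ u : Rd d, ∫⁻ v, g (v +ᵥ W ω) *
        ((T i ×ˢ B) ×ˢ B).indicator (1 : (G × Rd d) × Rd d → ℝ≥0∞) ((W ω, u), v + u)
        ≤ (W ⁻¹' T i).indicator (fun _ => i.2.1 * volume B) ω := by
      intro ω
      by_cases hω : W ω ∈ T i
      · rw [Set.indicator_of_mem (show ω ∈ W ⁻¹' T i from hω)]
        have h1 : I (2 * ρ i) (W ω) ≤ i.2.1 := hω.1.resolve_right (hfin ω _)
        calc _ ≤ ∫⁻ u : Rd d, B.indicator (fun _ => I (2 * ρ i) (W ω)) u := by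
              refine lintegral_mono fun u => ?_
              by_cases hu : u ∈ B
              · rw [Set.indicator_of_mem hu]
                simp only [I]
                rw [← lintegral_indicator measurableSet_ball]
                refine lintegral_mono fun v => ?_
                by_cases hv : v + u ∈ B
                -- Two sites in the ball of radius `ρ i` differ by less than `2 * ρ i`; hence the
                -- radius in `T`.
                · have hv' : v ∈ Metric.ball (0 : Rd d) (2 * ρ i) := by
                    simp only [B, Metric.mem_ball, dist_zero_right] at hu hv ⊢
                    have := norm_sub_le (v + u) u
                    rw [add_sub_cancel_right] at this
                    linarith
                  rw [Set.indicator_of_mem hv']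
                  exact mul_le_of_le_one_right' (Set.indicator_le_self' (by simp) _)
                · rw [Set.indicator_of_notMem (fun h => hv h.2), mul_zero]
                  exact zero_le
              · rw [Set.indicator_of_notMem hu]
                refine le_of_eq (lintegral_eq_zero_of_ae_eq_zero (ae_of_all _ fun v => ?_))
                simp only [Pi.zero_apply]
                rw [Set.indicator_of_notMem (fun h => hu h.1.2), mul_zero]
          _ = I (2 * ρ i) (W ω) * volume B := by
              rw [lintegral_indicator_const hB]
          _ ≤ _ := by gcongr
      · rw [Set.indicator_of_notMem (show ω ∉ W ⁻¹' T i from hω)]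
        refine le_of_eq (lintegral_eq_zero_of_ae_eq_zero (ae_of_all _ fun u => ?_))
        refine lintegral_eq_zero_of_ae_eq_zero (ae_of_all _ fun v => ?_)
        simp only [Pi.zero_apply]
        rw [Set.indicator_of_notMem (fun h => hω h.1.1), mul_zero]
    refine ne_top_of_le_ne_top ?_ (lintegral_mono hle)
    rw [lintegral_indicator_const (hW (hTm i)), ← Measure.map_apply hW (hTm i)]
    refine ENNReal.mul_ne_top (ENNReal.mul_ne_top (ENNReal.natCast_ne_top _)
      Metric.isBounded_ball.measure_lt_top.ne) ?_
    exact ((measure_mono Set.inter_subset_right).trans_lt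
      (measure_spanningSets_lt_top (Q.map W) i.2.2)).ne
  · intro C hC R hR
    have hset : MeasurableSet ((R ∩ Prod.snd ⁻¹' C) ×ˢ C) :=
      (hR.inter (measurable_snd hC.2.1)).prod hC.2.1
    rw [← lintegral_indicator_one hset,
      lintegral_map_shiftedPairMeasure hW hg hm₂ (measurable_one.indicator hset),
      ← lintegral_indicator_one hset,
      lintegral_map_shiftedPairMeasure hW hg hm₁ (measurable_one.indicator hset)]
    refine Eq.trans (Eq.trans ?_ (hbal C hC R hR).symm) ?_
    · refine lintegral_congr fun ω => ?_
      rw [← lintegral_indicator hC.2.1]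
      refine lintegral_congr fun u => ?_
      by_cases hu : u ∈ C
      · rw [Set.indicator_of_mem hu, ← lintegral_indicator (hvu hC.2.1 u)]
        refine lintegral_congr fun v => ?_
        by_cases hv : v + u ∈ C
        · rw [Set.indicator_of_mem (show v ∈ {v | v + u ∈ C} from hv)]
          by_cases hR' : (W ω, u) ∈ R <;> simp [Set.indicator, hu, hv, hR']
        · simp [Set.indicator, hv]
      · simp [Set.indicator, hu]
    · refine lintegral_congr fun ω => ?_
      rw [← lintegral_indicator hC.2.1]
      refine lintegral_congr fun u => ?_
      by_cases hu : u ∈ C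
      · rw [Set.indicator_of_mem hu, ← lintegral_indicator (hvu hC.2.1 u)]
        refine lintegral_congr fun v => ?_
        by_cases hv : v + u ∈ C
        · rw [Set.indicator_of_mem (show v ∈ {v | v + u ∈ C} from hv)]
          by_cases hR' : (v +ᵥ W ω, v + u) ∈ R <;> simp [Set.indicator, hu, hv, hR']
        · simp [Set.indicator, hv]
      · simp [Set.indicator, hu]

/-- If the two images of `g(v + W) Q(dω) du dv` coincide, then the average of the law of `v + W`
under `Q / g(W)` over `v ∈ A` is the law of `W` under `Q / g(W)`. -/
theorem lintegral_average_shift_eq {Q : Measure Ω} [SFinite Q] {W : Ω → G} (hW : Measurable W)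
    {g : G → ℝ≥0} (hg : Measurable g) (hpos : ∀ ω (v : Rd d), 0 < g (v +ᵥ W ω))
    (hmap : (shiftedPairMeasure Q W g).map
        (fun p : Ω × Rd d × Rd d => ((p.2.2 +ᵥ W p.1, p.2.2 + p.2.1), p.2.1)) =
      (shiftedPairMeasure Q W g).map (fun p : Ω × Rd d × Rd d => ((W p.1, p.2.1), p.2.2 + p.2.1)))
    {h : G → ℝ≥0∞} (hh : Measurable h) {A : Set (Rd d)} (hA : MeasurableSet A) :
    ∫⁻ ω, ∫⁻ v in A, (g (W ω) : ℝ≥0∞)⁻¹ * h (v +ᵥ W ω) ∂volume ∂Q =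
      volume A * ∫⁻ ω, (g (W ω) : ℝ≥0∞)⁻¹ * h (W ω) ∂Q := by
  have hm₁ : Measurable fun p : Ω × Rd d × Rd d =>
      ((p.2.2 +ᵥ W p.1, p.2.2 + p.2.1), p.2.1) :=
    ((measurable_vadd_comp (by fun_prop) (by fun_prop)).prodMk (by fun_prop)).prodMk
      (by fun_prop)
  have hm₂ : Measurable fun p : Ω × Rd d × Rd d => ((W p.1, p.2.1), p.2.2 + p.2.1) := by
    fun_prop
  have hWv : ∀ ω (v : Rd d), (g (v +ᵥ W ω) : ℝ≥0∞) ≠ 0 := fun ω v => by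
    exact_mod_cast (hpos ω v).ne'
  set B : Set (Rd d) := Metric.ball 0 1
  have hB : MeasurableSet B := measurableSet_ball
  have hB0 : volume B ≠ 0 := (Metric.measure_ball_pos volume 0 one_pos).ne'
  have hB1 : volume B ≠ ∞ := Metric.isBounded_ball.measure_lt_top.ne
  -- The two inverse factors are the densities seen from either site. In each image one of them
  -- cancels the weight `g (v +ᵥ W ω)` and the other leaves `(g (W ω))⁻¹`. The indicator of `A`
  -- restricts the difference of the sites, and that of `B` makes the integral over the remaining
  -- site finite.
  let F : (G × Rd d) × Rd d → ℝ≥0∞ := fun p =>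
    (h p.1.1 * A.indicator 1 (p.1.2 - p.2) * B.indicator 1 p.2) *
      ((g p.1.1 : ℝ≥0∞)⁻¹ * (g ((p.2 - p.1.2) +ᵥ p.1.1) : ℝ≥0∞)⁻¹)
  have hF : Measurable F := by
    refine Measurable.mul (Measurable.mul (Measurable.mul (by fun_prop) ?_) ?_)
      (Measurable.mul (by fun_prop) ?_)
    · exact (measurable_one.indicator hA).comp (by fun_prop)
    · exact (measurable_one.indicator hB).comp (by fun_prop)
    · exact (hg.comp (measurable_vadd_comp (by fun_prop)
        (by fun_prop))).coe_nnreal_ennreal.inv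
  have hhm : ∀ ω, Measurable fun v : Rd d => h (v +ᵥ W ω) := fun ω =>
    hh.comp (measurable_vadd_comp measurable_id measurable_const)
  have e := congrArg (fun L => ∫⁻ p, F p ∂L) hmap
  rw [lintegral_map_shiftedPairMeasure hW hg hm₁ hF,
    lintegral_map_shiftedPairMeasure hW hg hm₂ hF] at e
  have e₁ : ∀ ω, ∫⁻ u : Rd d, ∫⁻ v, g (v +ᵥ W ω) * F ((v +ᵥ W ω, v + u), u) =
      volume B * ∫⁻ v in A, (g (W ω) : ℝ≥0∞)⁻¹ * h (v +ᵥ W ω) := by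
    intro ω
    calc _ = ∫⁻ u : Rd d, B.indicator 1 u *
          ∫⁻ v in A, (g (W ω) : ℝ≥0∞)⁻¹ * h (v +ᵥ W ω) := by
          refine lintegral_congr fun u => ?_
          rw [← lintegral_indicator hA, ← lintegral_const_mul _
            (((hhm ω).const_mul _).indicator hA)]
          refine lintegral_congr fun v => ?_
          simp only [F]
          rw [vadd_vadd, show u - (v + u) + v = 0 by abel, zero_vadd, add_sub_cancel_right]
          by_cases hv : v ∈ A
          · rw [Set.indicator_of_mem hv, Set.indicator_of_mem hv, Pi.one_apply]
            calc _ = ((g (v +ᵥ W ω) : ℝ≥0∞) * (g (v +ᵥ W ω) : ℝ≥0∞)⁻¹) *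
                  (B.indicator 1 u * ((g (W ω) : ℝ≥0∞)⁻¹ * h (v +ᵥ W ω))) := by ring
              _ = _ := by rw [ENNReal.mul_inv_cancel (hWv ω v) ENNReal.coe_ne_top, one_mul]
          · simp [hv]
      _ = _ := by
          rw [lintegral_mul_const _ (measurable_one.indicator hB), lintegral_indicator_one hB]
  have e₂ : ∀ ω, ∫⁻ u : Rd d, ∫⁻ v, g (v +ᵥ W ω) * F ((W ω, u), v + u) =
      volume B * (volume A * ((g (W ω) : ℝ≥0∞)⁻¹ * h (W ω))) := by
    intro ω
    have hAn : Measurable fun v : Rd d => A.indicator (1 : Rd d → ℝ≥0∞) (-v) :=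
      (measurable_one.indicator hA).comp measurable_neg
    have hBi : Measurable fun p : Rd d × Rd d => B.indicator (1 : Rd d → ℝ≥0∞) (p.2 + p.1) :=
      (measurable_one.indicator hB).comp (by fun_prop)
    calc _ = ∫⁻ u : Rd d, ∫⁻ v : Rd d, A.indicator 1 (-v) * B.indicator 1 (v + u) *
          ((g (W ω) : ℝ≥0∞)⁻¹ * h (W ω)) := by
          refine lintegral_congr fun u => lintegral_congr fun v => ?_
          simp only [F]
          rw [add_sub_cancel_right, show u - (v + u) = -v by abel]
          calc _ = ((g (v +ᵥ W ω) : ℝ≥0∞) * (g (v +ᵥ W ω) : ℝ≥0∞)⁻¹) *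
                (A.indicator 1 (-v) * B.indicator 1 (v + u) *
                  ((g (W ω) : ℝ≥0∞)⁻¹ * h (W ω))) := by ring
            _ = _ := by rw [ENNReal.mul_inv_cancel (hWv ω v) ENNReal.coe_ne_top, one_mul]
      -- With `u` integrated before `v`, translation invariance produces the factor `volume B`,
      -- independent of `v`.
      _ = ∫⁻ v : Rd d, ∫⁻ u : Rd d, A.indicator 1 (-v) * B.indicator 1 (v + u) *
          ((g (W ω) : ℝ≥0∞)⁻¹ * h (W ω)) := by
          refine lintegral_lintegral_swap (Measurable.aemeasurable ?_)
          exact ((hAn.comp measurable_snd).mul hBi).mul_const _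
      _ = ∫⁻ v : Rd d, A.indicator 1 (-v) * (volume B * ((g (W ω) : ℝ≥0∞)⁻¹ * h (W ω))) := by
          refine lintegral_congr fun v => ?_
          have hBv : Measurable fun u : Rd d => B.indicator (1 : Rd d → ℝ≥0∞) (v + u) :=
            (measurable_one.indicator hB).comp (by fun_prop)
          simp only [mul_assoc]
          rw [lintegral_const_mul _ (hBv.mul_const _), lintegral_mul_const _ hBv,
            lintegral_add_left_eq_self (fun x => B.indicator 1 x) v, lintegral_indicator_one hB]
      _ = _ := by
          rw [lintegral_mul_const _ hAn, lintegral_neg_eq_self (fun v => A.indicator 1 v),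
            lintegral_indicator_one hA]
          ring
  simp only [e₁, e₂] at e
  rw [lintegral_const_mul' _ _ hB1, lintegral_const_mul' _ _ hB1,
    ENNReal.mul_right_inj hB0 hB1] at e
  rw [e, lintegral_const_mul]
  fun_prop

/-- Averaged invariance for all test functions implies invariance under each single shift. -/
theorem lintegral_shift_eq_of_average {Q : Measure Ω} {W : Ω → G} {q : Ω → ℝ≥0∞}
    (hav : ∀ h : G → ℝ≥0∞, Measurable h → ∀ A : Set (Rd d), MeasurableSet A →
      ∫⁻ ω, ∫⁻ v in A, q ω * h (v +ᵥ W ω) ∂volume ∂Q = volume A * ∫⁻ ω, q ω * h (W ω) ∂Q)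
    {h : G → ℝ≥0∞} (hh : Measurable h) (t : Rd d) :
    ∫⁻ ω, q ω * h (t +ᵥ W ω) ∂Q = ∫⁻ ω, q ω * h (W ω) ∂Q := by
  set B : Set (Rd d) := Metric.ball 0 1
  have hB : MeasurableSet B := measurableSet_ball
  have hB0 : volume B ≠ 0 := (Metric.measure_ball_pos volume 0 one_pos).ne'
  have hB1 : volume B ≠ ∞ := Metric.isBounded_ball.measure_lt_top.ne
  have htB : MeasurableSet ((fun v => t + v) ⁻¹' (B : Set (Rd d))) := (measurable_const_add t) hB
  -- Averaging `h (t +ᵥ ·)` over the translate of `B` by `-t` is averaging `h` over `B`, and the two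
  -- sets have equal volume.
  have h₁ := hav (fun w => h (t +ᵥ w))
    (hh.comp (measurable_vadd_comp measurable_const measurable_id)) _ htB
  have h₂ := hav h hh B hB
  rw [measure_preimage_add] at h₁
  have h₃ : ∀ ω, ∫⁻ v in (fun v => t + v) ⁻¹' B, q ω * h (t +ᵥ (v +ᵥ W ω)) =
      ∫⁻ v in B, q ω * h (v +ᵥ W ω) := by
    intro ω
    rw [← lintegral_indicator htB, ← lintegral_indicator hB,
      ← lintegral_add_left_eq_self (fun v => B.indicator (fun v => q ω * h (v +ᵥ W ω)) v) t]
    refine lintegral_congr fun v => ?_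
    simp only [Set.indicator, vadd_vadd]
    rfl
  simp only [h₃] at h₁
  rwa [h₂, ENNReal.mul_right_inj hB0 hB1, eq_comm] at h₁

end ShiftInvariance

/-! ### Path spaces and the random measure as a function of its density -/

instance {M α β : Type*} [MeasurableSpace M] [MeasurableSpace α] [MeasurableSpace β]
    [VAdd M α] [VAdd M β] [MeasurableVAdd₂ M α] [MeasurableVAdd₂ M β] :
    MeasurableVAdd₂ M (α × β) :=
  ⟨(measurable_vadd.comp (f := fun p : M × α × β => (p.1, p.2.1)) (by fun_prop)).prodMk
    (measurable_vadd.comp (f := fun p : M × α × β => (p.1, p.2.2)) (by fun_prop))⟩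

/-- A locally finite measure as an element of `LocFinMeasure d`. -/
def LocFinMeasure.ofMeasure {d : ℕ} (μ : Measure (Rd d)) (h : IsLocallyFiniteMeasure μ) :
    LocFinMeasure d := ⟨μ, h⟩

namespace FieldSpace

variable {d : ℕ} (F : FieldSpace d)

instance : MeasurableVAdd₂ (Rd d) F.Path := ⟨F.measurable_shift⟩

theorem vadd_apply (t : Rd d) (z : F.Path) (s : Rd d) : (t +ᵥ z) s = z (t + s) := rfl

theorem measurable_eval (s : Rd d) : Measurable fun z : F.Path => z s :=
  (measurable_pi_apply s).comp measurable_subtype_coe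

/-- Joint measurability of the shift gives that of the field, because $z_s=(\theta_sz)_0$. -/
theorem measurable_eval_uncurry : Measurable fun p : F.Path × Rd d => p.1 p.2 := by
  have h : Measurable fun p : F.Path × Rd d => (p.2 +ᵥ p.1) (0 : Rd d) :=
    (F.measurable_eval 0).comp (measurable_vadd_comp measurable_snd measurable_fst)
  simpa only [vadd_apply, add_zero] using h

theorem measurable_path (z : F.Path) : Measurable fun s => (z s : ℝ≥0∞) :=
  (F.measurable_eval_uncurry.comp measurable_prodMk_left).coe_nnreal_ennreal

theorem measurable_setLIntegral (B : Set (Rd d)) :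
    Measurable fun z : F.Path => ∫⁻ s in B, (z s : ℝ≥0∞) :=
  Measurable.lintegral_prod_right' (f := fun p : F.Path × Rd d => (p.1 p.2 : ℝ≥0∞))
    F.measurable_eval_uncurry.coe_nnreal_ennreal

/-- The measure with density `z`. -/
noncomputable def densityMeasure (z : F.Path) : Measure (Rd d) :=
  volume.withDensity fun s => (z s : ℝ≥0∞)

/-- Countably many integrals decide local finiteness, which makes it a measurable condition on the
path. -/
theorem isLocallyFiniteMeasure_densityMeasure_iff (z : F.Path) :
    IsLocallyFiniteMeasure (F.densityMeasure z) ↔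
      ∀ n : ℕ, ∫⁻ s in Metric.ball (0 : Rd d) n, (z s : ℝ≥0∞) < ∞ := by
  constructor
  · intro h n
    rw [← withDensity_apply _ measurableSet_ball]
    exact Metric.isBounded_ball.measure_lt_top (μ := F.densityMeasure z)
  · refine fun h => ⟨fun x => ?_⟩
    obtain ⟨n, hn⟩ := exists_nat_gt ‖x‖
    refine ⟨Metric.ball 0 n, Metric.isOpen_ball.mem_nhds (by simpa using hn), ?_⟩
    rw [densityMeasure, withDensity_apply _ measurableSet_ball]
    exact h n

open Classical in
/-- The locally finite measure with density `z`; the zero measure if `z` is not locally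
integrable. -/
noncomputable def locFinMeasure (z : F.Path) : LocFinMeasure d :=
  if h : IsLocallyFiniteMeasure (F.densityMeasure z) then
    LocFinMeasure.ofMeasure (F.densityMeasure z) h
  else LocFinMeasure.ofMeasure 0 inferInstance

theorem locFinMeasure_eq {z : F.Path} {μ : LocFinMeasure d}
    (h : μ.toMeasure = F.densityMeasure z) : F.locFinMeasure z = μ := by
  have hz : IsLocallyFiniteMeasure (F.densityMeasure z) := h ▸ μ.2
  rw [locFinMeasure, dif_pos hz]
  exact LocFinMeasure.ext h.symm

theorem measurable_locFinMeasure : Measurable F.locFinMeasure := by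
  classical
  rw [measurable_comap_iff]
  refine Measure.measurable_of_measurable_coe _ fun B hB => ?_
  have hset : MeasurableSet {z : F.Path | IsLocallyFiniteMeasure (F.densityMeasure z)} := by
    simp only [isLocallyFiniteMeasure_densityMeasure_iff, Set.ofPred_forall]
    exact MeasurableSet.iInter fun n =>
      measurableSet_lt (F.measurable_setLIntegral _) measurable_const
  have : (fun z => (LocFinMeasure.toMeasure ∘ F.locFinMeasure) z B) =
      fun z => if IsLocallyFiniteMeasure (F.densityMeasure z) then ∫⁻ s in B, (z s : ℝ≥0∞)
        else 0 := by
    funext z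
    by_cases h : IsLocallyFiniteMeasure (F.densityMeasure z)
    · simp only [Function.comp_apply, locFinMeasure, dif_pos h, if_pos h]
      exact withDensity_apply _ hB
    · simp only [Function.comp_apply, locFinMeasure, dif_neg h, if_neg h]
      rfl
  rw [this]
  exact Measurable.ite hset (F.measurable_setLIntegral B) measurable_const

theorem toMeasure_vadd_eq {z : F.Path} {μ : LocFinMeasure d}
    (h : μ.toMeasure = F.densityMeasure z) (t : Rd d) :
    (t +ᵥ μ).toMeasure = F.densityMeasure (t +ᵥ z) := by
  change μ.toMeasure.map (fun y => y - t) = _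
  ext B hB
  have hs : Measurable fun y : Rd d => y - t := by fun_prop
  rw [Measure.map_apply hs hB, h, densityMeasure, densityMeasure, withDensity_apply _ (hs hB),
    withDensity_apply _ hB, ← lintegral_indicator (hs hB), ← lintegral_indicator hB,
    ← lintegral_add_left_eq_self _ t]
  refine lintegral_congr fun s => ?_
  have hmem : t + s ∈ (fun y => y - t) ⁻¹' B ↔ s ∈ B := by
    rw [Set.mem_preimage, add_sub_cancel_left]
  by_cases hsB : s ∈ B
  · rw [Set.indicator_of_mem (hmem.2 hsB), Set.indicator_of_mem hsB]
    rfl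
  · rw [Set.indicator_of_notMem (mt hmem.1 hsB), Set.indicator_of_notMem hsB]

end FieldSpace

/-! ### Laws under a change of density -/

theorem identDistrib_of_lintegral_eq {Ω α : Type*} [MeasurableSpace Ω] [MeasurableSpace α]
    {P : Measure Ω} {Y Y' : Ω → α} (hY : Measurable Y) (hY' : Measurable Y')
    (h : ∀ f : α → ℝ≥0∞, Measurable f → ∫⁻ ω, f (Y ω) ∂P = ∫⁻ ω, f (Y' ω) ∂P) :
    IdentDistrib Y Y' P P := by
  refine ⟨hY.aemeasurable, hY'.aemeasurable, Measure.ext fun B hB => ?_⟩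
  have hB' : Measurable (B.indicator (1 : α → ℝ≥0∞)) := measurable_one.indicator hB
  rw [← lintegral_indicator_one hB, ← lintegral_indicator_one hB, lintegral_map hB' hY,
    lintegral_map hB' hY', h _ hB']

/-- The density factors through `Y`, so it passes to the law of `Y`; a finite density preserves
σ-finiteness. -/
theorem sigmaFinite_map_withDensity_comp {Ω α : Type*} [MeasurableSpace Ω] [MeasurableSpace α]
    {Q : Measure Ω} {Y : Ω → α} (hY : Measurable Y) [SigmaFinite (Q.map Y)] {k : α → ℝ≥0∞}
    (hk : Measurable k) (hfin : ∀ ω, k (Y ω) ≠ ∞) :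
    SigmaFinite ((Q.withDensity fun ω => k (Y ω)).map Y) := by
  have h : (Q.withDensity fun ω => k (Y ω)).map Y = (Q.map Y).withDensity k := by
    ext B hB
    rw [Measure.map_apply hY hB, withDensity_apply _ (hY hB), withDensity_apply _ hB,
      setLIntegral_map hB hk hY]
  rw [h]
  refine SigmaFinite.withDensity_of_ne_top ?_
  exact (ae_map_iff hY.aemeasurable (measurableSet_eq_fun hk measurable_const).compl).2
    (ae_of_all _ hfin)

/-! ### Removing the normalisation from mass-stationarity -/

/-- For a random measure with a positive density, mass-stationarity is an identity between
integrals against unnormalised measures. -/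
theorem IsMassStationary.lintegral_balance {d : ℕ} {Ω E : Type*} [MeasurableSpace Ω]
    [MeasurableSpace E] [AddAction (Rd d) E] {F : FieldSpace d} {X : Ω → E} {Z : Ω → F.Path}
    {ξ : Ω → LocFinMeasure d}
    (hdensity : ∀ ω, (ξ ω).toMeasure = F.densityMeasure (Z ω))
    (hpos : ∀ ω s, 0 < Z ω s) {Q : Measure Ω}
    (hmass : IsMassStationary Q (fun ω => (X ω, Z ω)) ξ)
    {C : Set (Rd d)} (hC : IsJordanSet C) {R : Set ((E × F.Path) × Rd d)} (hR : MeasurableSet R)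
    (hshift : ∀ ω, Measurable fun v : Rd d => v +ᵥ (X ω, Z ω)) :
    ∫⁻ ω, ∫⁻ u in C, ∫⁻ v in {v | v + u ∈ C},
        Z ω v * R.indicator 1 (v +ᵥ (X ω, Z ω), v + u) ∂volume ∂volume ∂Q =
      ∫⁻ ω, ∫⁻ u in C, ∫⁻ v in {v | v + u ∈ C},
        Z ω v * R.indicator 1 ((X ω, Z ω), u) ∂volume ∂volume ∂Q := by
  obtain ⟨hbdd, hCm, hfr⟩ := hC
  have hCt : volume C ≠ ∞ := hbdd.measure_lt_top.ne
  rcases eq_or_ne (volume C) 0 with h0 | h0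
  -- Mass-stationarity says nothing about null sets `C`, but both sides vanish there. The case is
  -- needed because differences of Jordan sets may be null.
  · simp [Measure.restrict_eq_zero.2 h0]
  have hS : ∀ u, MeasurableSet {v : Rd d | v + u ∈ C} := fun u => (measurable_add_const u) hCm
  have hR1 : Measurable (R.indicator (1 : (E × F.Path) × Rd d → ℝ≥0∞)) :=
    measurable_one.indicator hR
  -- $D(z,u)=\int_{C-u}z_v\,dv$ is the mass by which the conditional law of $V_C$ is normalised.
  -- Positivity of $Z$ and local finiteness of $\xi$ put it strictly between 0 and ∞.
  let D : F.Path × Rd d → ℝ≥0∞ := fun p => ∫⁻ v in {v | v + p.2 ∈ C}, (p.1 v : ℝ≥0∞)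
  have hD : Measurable D := by
    have : D = fun p => ∫⁻ v, C.indicator 1 (v + p.2) * (p.1 v : ℝ≥0∞) := by
      funext p
      simp only [D]
      rw [← lintegral_indicator (hS p.2)]
      refine lintegral_congr fun v => ?_
      by_cases hv : v + p.2 ∈ C
      · rw [Set.indicator_of_mem (show v ∈ {v | v + p.2 ∈ C} from hv), Set.indicator_of_mem hv,
          Pi.one_apply, one_mul]
      · rw [Set.indicator_of_notMem (show v ∉ {v | v + p.2 ∈ C} from hv),
          Set.indicator_of_notMem hv, zero_mul]
    rw [this]
    refine Measurable.lintegral_prod_right' (f := fun q : (F.Path × Rd d) × Rd d =>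
      C.indicator (1 : Rd d → ℝ≥0∞) (q.2 + q.1.2) * (q.1.1 q.2 : ℝ≥0∞)) (Measurable.mul ?_ ?_)
    · exact (measurable_one.indicator hCm).comp (by fun_prop)
    · exact (F.measurable_eval_uncurry.comp (f := fun q : (F.Path × Rd d) × Rd d =>
        (q.1.1, q.2)) (by fun_prop)).coe_nnreal_ennreal
  have hDξ : ∀ ω u, (ξ ω).toMeasure {v | v + u ∈ C} = D (Z ω, u) := fun ω u => by
    rw [hdensity, FieldSpace.densityMeasure, withDensity_apply _ (hS u)]
  have hDtop : ∀ ω u, D (Z ω, u) ≠ ∞ := fun ω u => by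
    rw [← hDξ]
    have : IsLocallyFiniteMeasure (ξ ω).toMeasure := (ξ ω).2
    refine (Bornology.IsBounded.measure_lt_top ?_).ne
    have : {v : Rd d | v + u ∈ C} ⊆ (fun x => -u + x) '' C := fun v hv => ⟨v + u, hv, by
      change -u + (v + u) = v
      abel⟩
    exact (hbdd.vadd (-u)).subset this
  have hD0 : ∀ ω u, D (Z ω, u) ≠ 0 := fun ω u => by
    have hpos' : 0 < D (Z ω, u) := by
      refine setLIntegral_pos_iff (F.measurable_path (Z ω)) |>.2 ?_
      have hsupp : (Function.support fun v => (Z ω v : ℝ≥0∞)) = Set.univ :=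
        Set.eq_univ_of_forall fun v => by
          rw [Function.mem_support]
          exact_mod_cast (hpos ω v).ne'
      rw [hsupp, Set.univ_inter]
      have := measure_preimage_add_right (volume : Measure (Rd d)) u C
      exact (pos_iff_ne_zero.2 h0).trans_eq this.symm
    exact hpos'.ne'
  -- The substitution $s\mapsto v+s$ carries $C-(v+u)$ to $C-u$. Thus the weight `D` in the test
  -- function can be evaluated at the unshifted pair and cancels the normalisation.
  have hDshift : ∀ (z : F.Path) (u v : Rd d), D (v +ᵥ z, v + u) = D (z, u) := by
    intro z u v
    simp only [D]
    rw [← lintegral_indicator (hS _), ← lintegral_indicator (hS _),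
      ← lintegral_add_left_eq_self (fun s => {v | v + u ∈ C}.indicator _ s) v]
    refine lintegral_congr fun s => ?_
    have hmem : v + s ∈ {s | s + u ∈ C} ↔ s ∈ {s | s + (v + u) ∈ C} := by
      change v + s + u ∈ C ↔ s + (v + u) ∈ C
      rw [show s + (v + u) = v + s + u by abel]
    by_cases hs : s ∈ {s | s + (v + u) ∈ C}
    · rw [Set.indicator_of_mem hs, Set.indicator_of_mem (hmem.2 hs)]
      rfl
    · rw [Set.indicator_of_notMem hs, Set.indicator_of_notMem (mt hmem.1 hs)]
  have hf : Measurable fun p : ((E × F.Path) × LocFinMeasure d) × Rd d =>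
      D (p.1.1.2, p.2) * R.indicator (1 : (E × F.Path) × Rd d → ℝ≥0∞) (p.1.1, p.2) :=
    (hD.comp (by fun_prop)).mul (hR1.comp (by fun_prop))
  have key := hmass.2 C hbdd hCm (pos_iff_ne_zero.2 h0) hfr _ hf
  have hl : ∀ ω u, ∫⁻ v, D ((v +ᵥ ((X ω, Z ω), ξ ω)).1.2, v + u) *
        R.indicator 1 ((v +ᵥ ((X ω, Z ω), ξ ω)).1, v + u)
          ∂((ξ ω).toMeasure[|{v | v + u ∈ C}]) =
      ∫⁻ v in {v | v + u ∈ C}, Z ω v * R.indicator 1 (v +ᵥ (X ω, Z ω), v + u) := by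
    intro ω u
    have hm : Measurable fun v : Rd d =>
        R.indicator (1 : (E × F.Path) × Rd d → ℝ≥0∞) (v +ᵥ (X ω, Z ω), v + u) :=
      hR1.comp ((hshift ω).prodMk (by fun_prop))
    have e : ∀ v : Rd d, D ((v +ᵥ ((X ω, Z ω), ξ ω)).1.2, v + u) *
        R.indicator (1 : (E × F.Path) × Rd d → ℝ≥0∞) ((v +ᵥ ((X ω, Z ω), ξ ω)).1, v + u) =
        D (Z ω, u) * R.indicator 1 (v +ᵥ (X ω, Z ω), v + u) := fun v => by
      rw [← hDshift (Z ω) u v]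
      rfl
    simp only [e]
    rw [lintegral_const_mul _ hm, ProbabilityTheory.cond, lintegral_smul_measure, hDξ, smul_eq_mul,
      ← mul_assoc,
      ENNReal.mul_inv_cancel (hD0 ω u) (hDtop ω u), one_mul, hdensity,
      FieldSpace.densityMeasure, restrict_withDensity (hS u),
      lintegral_withDensity_eq_lintegral_mul _ (F.measurable_path _) hm]
    rfl
  have hr : ∀ ω u, D (Z ω, u) * R.indicator (1 : (E × F.Path) × Rd d → ℝ≥0∞) ((X ω, Z ω), u) =
      ∫⁻ v in {v | v + u ∈ C}, Z ω v * R.indicator 1 ((X ω, Z ω), u) := by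
    intro ω u
    rw [lintegral_mul_const _ (F.measurable_path _)]
  simp only [hl, hr] at key
  simp only [ProbabilityTheory.cond, lintegral_smul_measure, smul_eq_mul] at key
  rwa [lintegral_const_mul' _ _ (ENNReal.inv_ne_top.2 h0),
    lintegral_const_mul' _ _ (ENNReal.inv_ne_top.2 h0),
    ENNReal.mul_right_inj (ENNReal.inv_ne_zero.2 hCt) (ENNReal.inv_ne_top.2 h0)] at key

/-! ### Stationarity and Palm's formula -/

theorem theorem5 {d : ℕ} {Ω E : Type*} [MeasurableSpace Ω] [MeasurableSpace E]
    [AddAction (Rd d) E] [MeasurableVAdd₂ (Rd d) E] (F : FieldSpace d)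
    (X : Ω → E) (hX : Measurable X)
    (Z : Ω → F.Path) (hZ : Measurable Z)
    (ξ : Ω → LocFinMeasure d) (hξ : Measurable ξ)
    (hdensity : ∀ ω, (ξ ω).toMeasure = volume.withDensity (fun s => (Z ω s : ℝ≥0∞)))
    (hpos : ∀ ω s, 0 < Z ω s)
    (Q P : Measure Ω)
    (hσ : SigmaFinite (Q.map (fun ω => ((X ω, Z ω), ξ ω))))
    (hmass : IsMassStationary Q (fun ω => (X ω, Z ω)) ξ)
    (hP : P = Q.withDensity (fun ω => (Z ω 0 : ℝ≥0∞)⁻¹)) :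
    SigmaFinite (P.map (fun ω => ((X ω, Z ω), ξ ω))) ∧
    IsStationaryUnder d P (fun ω => (X ω, Z ω)) ∧
    IsPalmVersion Q (fun ω => (X ω, Z ω)) ξ P (fun ω => (X ω, Z ω)) ξ := by
  set W : Ω → E × F.Path := fun ω => (X ω, Z ω)
  have hW : Measurable W := hX.prodMk hZ
  have hY : Measurable fun ω => (W ω, ξ ω) := hW.prodMk hξ
  let g : E × F.Path → ℝ≥0 := fun w => w.2 0
  have hg : Measurable g := (F.measurable_eval 0).comp measurable_snd
  have hgZ : ∀ ω (v : Rd d), g (v +ᵥ W ω) = Z ω v := fun ω v =>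
    congrArg (Z ω).1 (add_zero v)
  -- `Ψ` recovers the triple from `W` and commutes with shifts along the values of `W`. It transfers
  -- stationarity from `W` to the triple, and σ-finiteness of the law in the opposite direction.
  let Ψ : E × F.Path → (E × F.Path) × LocFinMeasure d := fun w => (w, F.locFinMeasure w.2)
  have hΨ : Measurable Ψ :=
    measurable_id.prodMk (F.measurable_locFinMeasure.comp measurable_snd)
  have hΨshift : ∀ (t : Rd d) ω, t +ᵥ (W ω, ξ ω) = Ψ (t +ᵥ W ω) := fun t ω =>
    Prod.ext rfl (F.locFinMeasure_eq (F.toMeasure_vadd_eq (hdensity ω) t)).symm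
  have hΨW : ∀ ω, (W ω, ξ ω) = Ψ (W ω) := fun ω =>
    Prod.ext rfl (F.locFinMeasure_eq (hdensity ω)).symm
  have hQ : SigmaFinite Q := SigmaFinite.of_map Q hY.aemeasurable hσ
  have hσW : SigmaFinite (Q.map W) := by
    refine SigmaFinite.of_map _ hΨ.aemeasurable ?_
    rw [Measure.map_map hΨ hW, show Ψ ∘ W = fun ω => (W ω, ξ ω) from
      funext fun ω => (hΨW ω).symm]
    exact hσ
  have hfin : ∀ ω (r : ℝ), ∫⁻ v in Metric.ball (0 : Rd d) r, g (v +ᵥ W ω) ≠ ∞ := fun ω r => by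
    simp only [hgZ]
    rw [← withDensity_apply _ measurableSet_ball, ← hdensity]
    have : IsLocallyFiniteMeasure (ξ ω).toMeasure := (ξ ω).2
    exact Metric.isBounded_ball.measure_lt_top.ne
  have hmap := map_shiftedPairMeasure_eq hW hg hfin (fun C hC R hR => by
    simp only [hgZ]
    exact hmass.lintegral_balance hdensity hpos hC hR
      fun ω => measurable_vadd_comp measurable_id measurable_const)
  have hav : ∀ h : E × F.Path → ℝ≥0∞, Measurable h → ∀ A : Set (Rd d), MeasurableSet A →
      ∫⁻ ω, ∫⁻ v in A, (Z ω 0 : ℝ≥0∞)⁻¹ * h (v +ᵥ W ω) ∂volume ∂Q =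
        volume A * ∫⁻ ω, (Z ω 0 : ℝ≥0∞)⁻¹ * h (W ω) ∂Q := fun h hh A hA =>
    lintegral_average_shift_eq hW hg (fun ω v => by rw [hgZ]; exact hpos ω v) hmap hh hA
  have hZ0 : Measurable fun ω => (Z ω 0 : ℝ≥0∞)⁻¹ :=
    ((F.measurable_eval 0).comp hZ).coe_nnreal_ennreal.inv
  have hPint : ∀ k : Ω → ℝ≥0∞, Measurable k →
      ∫⁻ ω, k ω ∂P = ∫⁻ ω, (Z ω 0 : ℝ≥0∞)⁻¹ * k ω ∂Q := fun k hk => by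
    rw [hP, lintegral_withDensity_eq_lintegral_mul _ hZ0 hk]
    rfl
  have hZne : ∀ ω, (Z ω 0 : ℝ≥0∞) ≠ 0 := fun ω => by exact_mod_cast (hpos ω 0).ne'
  have hWshift : ∀ t : Rd d, Measurable fun ω => t +ᵥ W ω := fun t =>
    measurable_vadd_comp measurable_const hW
  have hstat : IsStationaryUnder d P W := fun t =>
    identDistrib_of_lintegral_eq (hWshift t) hW fun f hf => by
      rw [hPint (fun ω => f (t +ᵥ W ω)) (hf.comp (hWshift t)),
        hPint (fun ω => f (W ω)) (hf.comp hW)]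
      exact lintegral_shift_eq_of_average hav hf t
  refine ⟨?_, hstat, fun t => ?_, fun f hf B hB hB0 hB1 => ?_⟩
  · rw [hP]
    exact sigmaFinite_map_withDensity_comp hY
      (k := fun y : (E × F.Path) × LocFinMeasure d => (y.1.2 0 : ℝ≥0∞)⁻¹)
      (hg.comp measurable_fst).coe_nnreal_ennreal.inv
      fun ω => ENNReal.inv_ne_top.2 (hZne ω)
  · have h := (hstat t).comp hΨ
    rwa [show Ψ ∘ (fun ω => t +ᵥ W ω) = fun ω => t +ᵥ (W ω, ξ ω) from
      funext fun ω => (hΨshift t ω).symm, show Ψ ∘ W = fun ω => (W ω, ξ ω) from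
      funext fun ω => (hΨW ω).symm] at h
  · have hh : Measurable fun w => f (Ψ w) := hf.comp hΨ
    have hgh : Measurable fun w => (g w : ℝ≥0∞) * f (Ψ w) := hg.coe_nnreal_ennreal.mul hh
    have hinner : ∀ ω, ∫⁻ t in B, f (t +ᵥ (W ω, ξ ω)) ∂((ξ ω).toMeasure) =
        ∫⁻ t in B, g (t +ᵥ W ω) * f (Ψ (t +ᵥ W ω)) := fun ω => by
      simp only [hΨshift, hgZ]
      rw [hdensity, restrict_withDensity hB]
      exact lintegral_withDensity_eq_lintegral_mul _ (F.measurable_path _)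
        (hh.comp (measurable_vadd_comp measurable_id measurable_const))
    have hm : Measurable fun ω => ∫⁻ t in B, g (t +ᵥ W ω) * f (Ψ (t +ᵥ W ω)) :=
      Measurable.lintegral_prod_right' (f := fun p : Ω × Rd d =>
        (g (p.2 +ᵥ W p.1) : ℝ≥0∞) * f (Ψ (p.2 +ᵥ W p.1)))
        (hgh.comp (measurable_vadd_comp measurable_snd (hW.comp measurable_fst)))
    -- With $h=Z_0\cdot f\circ\Psi$, the factor $Z_0$ becomes the density $Z_v$ of $\xi$ on the
    -- averaged side and cancels $1/Z_0$ on the other.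
    have hrhs := hav _ hgh B hB
    have hcancel : ∀ ω, (Z ω 0 : ℝ≥0∞)⁻¹ * (g (W ω) * f (Ψ (W ω))) = f (W ω, ξ ω) := fun ω => by
      rw [← mul_assoc, hΨW]
      change (Z ω 0 : ℝ≥0∞)⁻¹ * (Z ω 0 : ℝ≥0∞) * _ = _
      rw [ENNReal.inv_mul_cancel (hZne ω) ENNReal.coe_ne_top, one_mul]
    have hconst : ∀ ω, ∫⁻ v in B, (Z ω 0 : ℝ≥0∞)⁻¹ * (g (v +ᵥ W ω) * f (Ψ (v +ᵥ W ω))) =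
        (Z ω 0 : ℝ≥0∞)⁻¹ * ∫⁻ v in B, g (v +ᵥ W ω) * f (Ψ (v +ᵥ W ω)) := fun ω =>
      lintegral_const_mul' _ _ (ENNReal.inv_ne_top.2 (hZne ω))
    simp only [hcancel, hconst] at hrhs
    simp only [hinner]
    rw [hPint _ hm, hrhs, mul_comm, ENNReal.mul_div_cancel_right hB0.ne' hB1.ne]
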